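/- A prefix-free machine is a partial computable function from binary strings to binary strings with prefix-free domain. Fix an optimal prefix-free machine $\mathbb U$ (for every prefix-free machine $L$ there is a constant $e$ such that whenever $L(\sigma)=y$ there is $\tau$ with $\mathbb U(\tau)=y$ and $|\tau|\le|\sigma|+e$), and let $K(y)=\min\{|\sigma| : \mathbb U(\sigma)=y\}$ for binary strings $y$. Fix an effective (computable, injective) encoding of the finite tuples over $\mathbb N$ by binary strings, so that $K(n)$, $K(p,n)$ and $K(\alpha\upharpoonright n)$ are defined, where $\alpha\upharpoonright n=(\alpha(0),\dots,\alpha(n-1))$ for $\alpha:\mathbb N\to\mathbb N$. Let $\mathcal M=(M,d,(q_i)_{i\in\mathbb N})$ be a computable metric space: $(M,d)$ is a complete metric space, $(q_i)_{i\in\mathbb N}$ is a dense sequence without repetitions (its elements are the special points, and $q_i$ is identified with $i$), and $d(q_i,q_k)$ is a computable real uniformly in $i,k$. A function $\alpha:\mathbb N\to\mathbb N$ is a Cauchy name for $x\in M$ if $d(q_{\alpha(s)},q_{\alpha(t)})\le 2^{-s}$ for all $s\le t$ and $\lim_s q_{\alpha(s)}=x$. For $b\in\mathbb N$, the function $\alpha$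 is $K$-trivial via $b$ if $K(\alpha\upharpoonright n)\le K(0^n)+b$ for all $n$. A point $x$ is $K$-trivial if it has a Cauchy name that is $K$-trivial via some $b\in\mathbb N$. A point $x$ is locally $K$-trivial via $b\in\mathbb N$ if for every $n$ there is a special point $p$ with $d(x,p)<2^{-n}$ and $K(p,n)\le K(n)+b$; it is locally $K$-trivial if this holds for some $b\in\mathbb N$. Then: (1) There is a constant $c\in\mathbb N$ (depending only on $\mathbb U$, the encoding and $\mathcal M$) such that for every $b\in\mathbb N$, every point $x\in M$ that is locally $K$-trivial via $b$ has a Cauchy name $h$ that is $K$-trivial via $b+c$. (2) There is a constant $c\in\mathbb N$ (depending only on $\mathbb U$, the encoding and $\mathcal M$) such that for every $v\in\mathbb N$, every point $x\in M$ that has a Cauchy name which is $K$-trivial via $v$ is locally $K$-trivial via $v+c$. (3) Consequently, a point of $M$ is $K$-trivial if and only if it is locally $K$-trivial. -/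

import Mathlib

open Filter Topology

/-- A prefix-free machine: a partial computable function from binary strings to binary strings
whose domain is prefix-free. -/
def IsPrefixFreeMachine (L : List Bool →. List Bool) : Prop :=
  Partrec L ∧ ∀ σ τ : List Bool, (L σ).Dom → (L τ).Dom → σ <+: τ → σ = τ

/-- An optimal prefix-free machine: it simulates every prefix-free machine with a constant
increase in the length of descriptions. -/
def IsOptimalPrefixFreeMachine (U : List Bool →. List Bool) : Prop :=
  IsPrefixFreeMachine U ∧
    ∀ L : List Bool →. List Bool, IsPrefixFreeMachine L →
      ∃ e : ℕ, ∀ σ y : List Bool, y ∈ L σ → ∃ τ : List Bool, y ∈ U τ ∧ τ.length ≤ σ.length + e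

/-- The prefix-free complexity `K(y)` of a binary string `y` with respect to the machine `U`:
the length of a shortest `U`-description of `y`. For optimal `U` every string has a description,
see `IsOptimalPrefixFreeMachine.exists_description`. -/
noncomputable def prefixComplexity (U : List Bool →. List Bool) (y : List Bool) : ℕ :=
  sInf {k : ℕ | ∃ σ : List Bool, y ∈ U σ ∧ σ.length = k}

theorem IsOptimalPrefixFreeMachine.exists_description {U : List Bool →. List Bool}
    (hU : IsOptimalPrefixFreeMachine U) (y : List Bool) :
    ∃ σ : List Bool, y ∈ U σ ∧ σ.length = prefixComplexity U y := by
  have hL : IsPrefixFreeMachine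
      (fun σ : List Bool => ((if σ = [] then some y else none : Option (List Bool)) :
        Part (List Bool))) := by
    constructor
    · refine Computable.ofOption (Primrec.to_comp ?_)
      exact Primrec.ite (Primrec.eq.comp Primrec.id (Primrec.const []))
        (Primrec.const (some y)) (Primrec.const none)
    · intro σ τ hσ hτ _
      by_cases h1 : σ = [] <;> by_cases h2 : τ = [] <;> simp_all
  obtain ⟨e, he⟩ := hU.2 _ hL
  obtain ⟨τ, hτ, -⟩ := he [] y (by simp)
  have hne : {k : ℕ | ∃ σ : List Bool, y ∈ U σ ∧ σ.length = k}.Nonempty := ⟨_, τ, hτ, rfl⟩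
  exact Nat.sInf_mem hne

/-- An effective encoding of the tuples over `ℕ` by binary strings. -/
def IsEffectiveEncoding (code : List ℕ → List Bool) : Prop :=
  Computable code ∧ Function.Injective code

/-- `K(t)` for a tuple `t` over `ℕ`; a number `n` is the tuple `[n]`, a pair is `[p, n]`. -/
noncomputable def tupleComplexity (U : List Bool →. List Bool) (code : List ℕ → List Bool)
    (t : List ℕ) : ℕ :=
  prefixComplexity U (code t)

/-- The function `α : ℕ → ℕ` is `K`-trivial via `b`: `K(α ↾ n) ≤ K(0ⁿ) + b` for all `n`, where
`α ↾ n` is the tuple `(α 0, …, α (n - 1))` and `0ⁿ` is the string of `n` zeros. -/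
def IsKTrivialVia (U : List Bool →. List Bool) (code : List ℕ → List Bool)
    (α : ℕ → ℕ) (b : ℕ) : Prop :=
  ∀ n : ℕ, tupleComplexity U code ((List.range n).map α) ≤
    prefixComplexity U (List.replicate n false) + b

/-- The sequence `r` of rationals is a Cauchy name for the real `z`. -/
def IsRealCauchyName (r : ℕ → ℚ) (z : ℝ) : Prop :=
  (∀ n : ℕ, |r (n + 1) - r n| ≤ (1 / 2 : ℚ) ^ (n + 1)) ∧
    Tendsto (fun n => (r n : ℝ)) atTop (𝓝 z)

/-- The reals `z i` are computable, uniformly in `i`: Cauchy names for them can be computed from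
`i`. The rational `(u - v) / (w + 1)` is given by the natural numbers `u`, `v`, `w`. -/
def IsUniformlyComputableReal {ι : Type*} [Primcodable ι] (z : ι → ℝ) : Prop :=
  ∃ u v w : ι → ℕ → ℕ, Computable₂ u ∧ Computable₂ v ∧ Computable₂ w ∧
    ∀ i : ι, IsRealCauchyName (fun n => ((u i n : ℚ) - (v i n : ℚ)) / ((w i n : ℚ) + 1)) (z i)

/-- The metric space `M` with the sequence `q` of special points is a computable metric space. -/
structure IsComputableMetricSpace {M : Type*} [MetricSpace M] (q : ℕ → M) : Prop where
  complete : CompleteSpace M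
  dense : DenseRange q
  injective : Function.Injective q
  computable_dist : IsUniformlyComputableReal (fun ik : ℕ × ℕ => dist (q ik.1) (q ik.2))

/-- `α` is (through the indices of special points) a Cauchy name for the point `x`. -/
def IsCauchyName {M : Type*} [MetricSpace M] (q : ℕ → M) (α : ℕ → ℕ) (x : M) : Prop :=
  (∀ s t : ℕ, s ≤ t → dist (q (α s)) (q (α t)) ≤ (1 / 2 : ℝ) ^ s) ∧
    Tendsto (fun s => q (α s)) atTop (𝓝 x)

/-- The point `x` is `K`-trivial: it has a Cauchy name that is `K`-trivial as a function. -/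
def IsKTrivialPoint (U : List Bool →. List Bool) (code : List ℕ → List Bool)
    {M : Type*} [MetricSpace M] (q : ℕ → M) (x : M) : Prop :=
  ∃ α : ℕ → ℕ, IsCauchyName q α x ∧ ∃ b : ℕ, IsKTrivialVia U code α b

/-- The point `x` is locally `K`-trivial via `b`: for every `n` there is a special point `p` with
`d(x, p) < 2⁻ⁿ` and `K(p, n) ≤ K(n) + b`. -/
def IsLocallyKTrivialVia (U : List Bool →. List Bool) (code : List ℕ → List Bool)
    {M : Type*} [MetricSpace M] (q : ℕ → M) (x : M) (b : ℕ) : Prop :=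
  ∀ n : ℕ, ∃ p : ℕ, dist x (q p) < (1 / 2 : ℝ) ^ n ∧
    tupleComplexity U code [p, n] ≤ tupleComplexity U code [n] + b

/-! Choosing a witness `p m` at every level gives a Cauchy name of `x`, but its initial segments may
be complex because they record many unrelated choices. Instead, a partial recursive function
attaches to each reachable end point of level `m` one whole chain of predecessors
(`REPred.exists_chain`), so that a chain costs, up to a constant, no more than its end point.

Such chains must be searchable, so `K` is replaced by a Solovay function `f`
(`exists_solovay_function`): it is computable, it bounds `K(m + 3)` up to a constant, and for each
`n` it equals `K(0ⁿ)` at some `m ≥ n` that computes `n`. Chosen chains of level `m` whose end points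
have complexity at most `f m + b`, for the suitably enlarged `b`, then have complexity at most `f m
+ b + O(1)` (`exists_tupleComplexity_le_of_description`). Those ending near `x` form a tree with
finite nonempty levels. A path `h` through it (`exists_path_of_finite_levels`) names `x`; cutting `h
↾ (m + 1)` down to length `n`, at the `m` belonging to `n`, gives the bound `K(0ⁿ) + b + O(1)`.

Conversely, `α ↾ (n + 2)` computes the pair `(α (n + 1), n)`, and `n` computes `0ⁿ⁺²`. -/

/-! ### Searching, stages and recursively enumerable predicates -/

section RecursionTheory

variable {α β γ : Type*} [Primcodable α] [Primcodable β] [Primcodable γ]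

theorem Partrec.exists_code_encode {f : α →. β} (hf : Partrec f) :
    ∃ c : Nat.Partrec.Code, ∀ (a : α) (n : ℕ),
      n ∈ c.eval (Encodable.encode a) ↔ ∃ b ∈ f a, Encodable.encode b = n := by
  obtain ⟨c, hc⟩ := Nat.Partrec.Code.exists_code.1 hf
  refine ⟨c, fun a n => ?_⟩
  simp [hc]

/-- Dovetailing: a partial recursive choice of a value of `H (a, b)` over all `b`. -/
theorem Partrec.exists_selector {H : α × β →. γ} (hH : Partrec H) :
    ∃ S : α →. γ, Partrec S ∧ (∀ a, ∀ c ∈ S a, ∃ b, c ∈ H (a, b)) ∧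
      ∀ a b, (H (a, b)).Dom → (S a).Dom := by
  obtain ⟨c, hc⟩ := hH.exists_code_encode
  let e : (α × β) × ℕ → Option ℕ := fun x =>
    Nat.Partrec.Code.evaln x.2 c (Encodable.encode x.1)
  have he : Computable e := Nat.Partrec.Code.primrec_evaln.to_comp.comp
    ((Computable.snd.pair (Computable.const c)).pair (Computable.encode.comp Computable.fst))
  -- The search index `k` codes a candidate `b` together with a step bound.
  let s : α → ℕ → Option γ := fun a k =>
    (Encodable.decode (α := β) k.unpair.1).bind fun b =>
      (e ((a, b), k.unpair.2)).bind fun n => Encodable.decode (α := γ) n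
  have hdec : Computable fun x : (α × ℕ) × β =>
      (e ((x.1.1, x.2), x.1.2.unpair.2)).bind fun n => Encodable.decode (α := γ) n := by
    have h1 : Computable fun x : (α × ℕ) × β => (((x.1.1, x.2), x.1.2.unpair.2) : (α × β) × ℕ) :=
      ((Computable.fst.comp Computable.fst).pair Computable.snd).pair
        (Computable.snd.comp (Computable.unpair.comp (Computable.snd.comp Computable.fst)))
    exact Computable.option_bind (he.comp h1) (Computable.decode.comp Computable.snd).to₂
  have hs : Computable₂ s := by
    have h1 : Computable fun x : α × ℕ => Encodable.decode (α := β) x.2.unpair.1 :=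
      Computable.decode.comp (Computable.fst.comp (Computable.unpair.comp Computable.snd))
    exact Computable.option_bind h1 hdec.to₂
  refine ⟨fun a => Nat.rfindOpt (s a), Partrec.rfindOpt hs, fun a x hx => ?_, fun a b hab => ?_⟩
  · obtain ⟨k, hk⟩ := Nat.rfindOpt_spec hx
    simp only [s, e, Option.mem_def, Option.bind_eq_some_iff] at hk
    obtain ⟨b, -, n, hn, hx⟩ := hk
    obtain ⟨y, hy, rfl⟩ := (hc (a, b) n).1 (Nat.Partrec.Code.evaln_sound hn)
    rw [Encodable.encodek, Option.some_inj] at hx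
    exact ⟨b, hx ▸ hy⟩
  · obtain ⟨y, hy⟩ := Part.dom_iff_mem.1 hab
    obtain ⟨k, hk⟩ := Nat.Partrec.Code.evaln_complete.1 ((hc (a, b) _).2 ⟨y, hy, rfl⟩)
    rw [Option.mem_def, Encodable.encode_prod_val] at hk
    exact Nat.rfindOpt_dom.2 ⟨Nat.pair (Encodable.encode b) k, y, by simp [s, e, hk]⟩

/-- The domain of a partial recursive function is the union of a computable family of sets, where
every element of the domain is enumerated at exactly one stage. -/
theorem Partrec.exists_stage {f : α →. β} (hf : Partrec f) :
    ∃ t : α × ℕ → Bool, Computable t ∧ (∀ a, (f a).Dom ↔ ∃ k, t (a, k)) ∧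
      ∀ a k l, t (a, k) → t (a, l) → k = l := by
  obtain ⟨c, hc⟩ := hf.exists_code_encode
  let e : α → ℕ → Bool := fun a k =>
    (Nat.Partrec.Code.evaln k c (Encodable.encode a)).isSome
  have he : Computable₂ e := Primrec.option_isSome.to_comp.comp
    (Nat.Partrec.Code.primrec_evaln.to_comp.comp
      ((Computable.snd.pair (Computable.const c)).pair (Computable.encode.comp Computable.fst)))
  have hmono : ∀ a k l, k ≤ l → e a k → e a l := fun a k l hkl h => by
    simp only [e, Option.isSome_iff_exists] at h ⊢
    exact h.imp fun n hn => Nat.Partrec.Code.evaln_mono hkl hn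
  have hdom : ∀ a, (f a).Dom ↔ ∃ k, e a k := fun a => by
    simp only [e, Option.isSome_iff_exists]
    constructor
    · intro h
      obtain ⟨y, hy⟩ := Part.dom_iff_mem.1 h
      obtain ⟨k, hk⟩ := Nat.Partrec.Code.evaln_complete.1 ((hc a _).2 ⟨y, hy, rfl⟩)
      exact ⟨k, _, hk⟩
    · rintro ⟨k, n, hn⟩
      obtain ⟨y, hy, -⟩ := (hc a n).1 (Nat.Partrec.Code.evaln_sound hn)
      exact Part.dom_iff_mem.2 ⟨y, hy⟩
  refine ⟨fun x => e x.1 (x.2 + 1) && !e x.1 x.2, ?_, fun a => ?_, fun a k l hk hl => ?_⟩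
  · exact Primrec.and.to_comp.comp
      (he.comp Computable.fst (Computable.succ.comp Computable.snd))
      (Primrec.not.to_comp.comp (he.comp Computable.fst Computable.snd))
  · rw [hdom]
    constructor
    · intro h
      classical
      -- `evaln` with bound `0` never halts, so the first halting bound is a successor `k + 1`,
      -- recorded as stage `k`.
      have h0 : Nat.find h ≠ 0 := fun h0 => by
        have := Nat.find_spec h
        rw [h0] at this
        simp [e, Nat.Partrec.Code.evaln] at this
      obtain ⟨k, hk⟩ := Nat.exists_eq_succ_of_ne_zero h0
      refine ⟨k, ?_⟩
      have h1 := Nat.find_spec h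
      have h2 := Nat.find_min h (m := k) (by omega)
      rw [hk] at h1
      simp_all
    · rintro ⟨k, hk⟩
      exact ⟨k + 1, by simp_all⟩
  · simp only [Bool.and_eq_true, Bool.not_eq_true'] at hk hl
    by_contra hne
    rcases lt_or_gt_of_ne hne with h | h
    · have := hmono a (k + 1) l h hk.1
      simp_all
    · have := hmono a (l + 1) k h hl.1
      simp_all

theorem REPred.comp {p : β → Prop} (hp : REPred p) {f : α → β} (hf : Computable f) :
    REPred fun a => p (f a) :=
  Partrec.comp hp hf

theorem REPred.and {p r : α → Prop} (hp : REPred p) (hr : REPred r) :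
    REPred fun a => p a ∧ r a := by
  refine (Partrec.dom_re (Partrec.bind hp (Partrec.comp hr Computable.fst).to₂)).of_eq
    fun a => ?_
  simp [Part.assert]

theorem REPred.exists {p : α × β → Prop} (hp : REPred p) : REPred fun a => ∃ b, p (a, b) := by
  obtain ⟨S, hS, h1, h2⟩ := Partrec.exists_selector hp
  refine hS.dom_re.of_eq fun a => ⟨fun h => ?_, fun ⟨b, hb⟩ => ?_⟩
  · obtain ⟨b, hb⟩ := h1 a _ (Part.get_mem h)
    exact ⟨b, by simpa using hb⟩
  · exact h2 a b ⟨hb, trivial⟩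

theorem Partrec.mem_re {f : α →. β} (hf : Partrec f) : REPred fun x : α × β => x.2 ∈ f x.1 := by
  classical
  have : Partrec fun x : α × β => (f x.1).bind fun y =>
      ((if y = x.2 then some () else Option.none : Option Unit) : Part Unit) := by
    refine (hf.comp Computable.fst).bind (Computable.ofOption (Primrec.to_comp ?_))
    exact Primrec.ite (Primrec.eq.comp Primrec.snd (Primrec.snd.comp Primrec.fst))
      (Primrec.const _) (Primrec.const _)
  refine this.dom_re.of_eq fun x => ?_
  simp only [Part.dom_iff_mem, Part.mem_bind_iff]
  constructor
  · rintro ⟨u, y, hy, h⟩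
    split_ifs at h with hxy
    · exact hxy ▸ hy
    · simp at h
  · exact fun h => ⟨(), x.2, h, by simp⟩

/-- Restricting a partial recursive function to a recursively enumerable set. -/
theorem Partrec.assert {f : α →. β} (hf : Partrec f) {p : α → Prop} (hp : REPred p) :
    Partrec fun a => Part.assert (p a) fun _ => f a := by
  refine (Partrec.bind hp (hf.comp Computable.fst).to₂).of_eq fun a => Part.ext fun y => ?_
  simp [Part.mem_assert_iff]

/-- Search for a preimage. Since `IsEffectiveEncoding` provides no decoder, this is how tuples are
recovered from their codes. -/
theorem Computable.exists_partrec_leftInverse {f : α → β} (hf : Computable f)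
    (hinj : Function.Injective f) :
    ∃ g : β →. α, Partrec g ∧ ∀ a a', a' ∈ g (f a) ↔ a' = a := by
  have hH : Partrec fun x : β × α => Part.assert (f x.2 = x.1) fun _ => Part.some x.2 :=
    Partrec.assert Computable.snd.partrec
      ((Partrec.mem_re hf.partrec).comp (Computable.snd.pair Computable.fst) |>.of_eq
        fun x => by simp [eq_comm])
  obtain ⟨S, hS, h1, h2⟩ := hH.exists_selector
  have h3 : ∀ a, ∀ a' ∈ S (f a), a' = a := fun a a' h => by
    obtain ⟨b, hb⟩ := h1 _ _ h
    obtain ⟨hb, hb'⟩ := Part.mem_assert_iff.1 hb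
    rw [Part.mem_some_iff] at hb'
    exact hb' ▸ hinj hb
  refine ⟨S, hS, fun a a' => ⟨h3 a a', ?_⟩⟩
  rintro rfl
  have hd := h2 (f a') a' ⟨rfl, trivial⟩
  have := Part.get_mem hd
  rwa [h3 _ _ this] at this

end RecursionTheory

/-! ### Uniform choice of chains -/

section ChainFunction

/-- For a recursively enumerable relation, read as `(b, m, p', p)`: the element `p` of level `m + 1`
may be appended to `p'` of level `m`, there is a partial recursive choice of a chain through all
lower levels such that initial segments of chosen chains are chosen chains. -/
theorem REPred.exists_chain {R : ((ℕ × ℕ) × ℕ) × ℕ → Prop} (hR : REPred R) :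
    ∃ F : (ℕ × ℕ) × ℕ →. List ℕ, Partrec F ∧
      (∀ b p l, l ∈ F ((b, 0), p) ↔ l = [p]) ∧
      (∀ b m p, ∀ l ∈ F ((b, m + 1), p),
        ∃ p', ∃ l' ∈ F ((b, m), p'), R (((b, m), p'), p) ∧ l = l' ++ [p]) ∧
      ∀ b m p p', (F ((b, m), p')).Dom → R (((b, m), p'), p) → (F ((b, m + 1), p)).Dom := by
  let E : Nat.Partrec.Code → (ℕ × ℕ) × ℕ →. List ℕ := fun c x =>
    (c.eval (Encodable.encode x)).bind fun n => (Encodable.decode (α := List ℕ) n : Part (List ℕ))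
  have hE : Partrec₂ E := by
    have h1 : Partrec fun x : Nat.Partrec.Code × ((ℕ × ℕ) × ℕ) =>
        x.1.eval (Encodable.encode x.2) :=
      Nat.Partrec.Code.eval_part.comp Computable.fst (Computable.encode.comp Computable.snd)
    exact h1.bind (Computable.ofOption (Computable.decode.comp Computable.snd)).to₂
  -- arguments: the code, the parameter `b`, the predecessor of the level, the end point
  let H : (Nat.Partrec.Code × ((ℕ × ℕ) × ℕ)) × ℕ →. List ℕ := fun x =>
    Part.assert (R ((x.1.2.1, x.2), x.1.2.2)) fun _ =>
      (E x.1.1 (x.1.2.1, x.2)).map fun l => l ++ [x.1.2.2]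
  have hH : Partrec H := by
    have c1 : Computable fun x : (Nat.Partrec.Code × ((ℕ × ℕ) × ℕ)) × ℕ => x.1.2.1 :=
      Computable.fst.comp (Computable.snd.comp Computable.fst)
    have c2 : Computable fun x : (Nat.Partrec.Code × ((ℕ × ℕ) × ℕ)) × ℕ => x.1.2.2 :=
      Computable.snd.comp (Computable.snd.comp Computable.fst)
    have c3 : Computable fun x : (Nat.Partrec.Code × ((ℕ × ℕ) × ℕ)) × ℕ => x.1.1 :=
      Computable.fst.comp Computable.fst
    have h1 := hE.comp c3 (c1.pair Computable.snd)
    refine Partrec.assert (h1.map ?_) (hR.comp ((c1.pair Computable.snd).pair c2))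
    exact (Computable.list_concat.comp Computable.snd (c2.comp Computable.fst)).to₂
  obtain ⟨S, hS, hS1, hS2⟩ := hH.exists_selector
  let G : Nat.Partrec.Code → (ℕ × ℕ) × ℕ →. List ℕ := fun c x =>
    Nat.casesOn x.1.2 (Part.some [x.2]) fun m => S (c, ((x.1.1, m), x.2))
  have hG : Partrec₂ G := by
    have c0 : Computable fun y : Nat.Partrec.Code × ((ℕ × ℕ) × ℕ) => y.2.1.2 :=
      Computable.snd.comp (Computable.fst.comp Computable.snd)
    have c1 : Computable fun y : Nat.Partrec.Code × ((ℕ × ℕ) × ℕ) => [y.2.2] :=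
      Computable.list_cons.comp (Computable.snd.comp Computable.snd) (Computable.const [])
    have c2 : Computable fun y : (Nat.Partrec.Code × ((ℕ × ℕ) × ℕ)) × ℕ =>
        (y.1.1, ((y.1.2.1.1, y.2), y.1.2.2)) :=
      (Computable.fst.comp Computable.fst).pair
        (((Computable.fst.comp (Computable.fst.comp (Computable.snd.comp Computable.fst))).pair
          Computable.snd).pair (Computable.snd.comp (Computable.snd.comp Computable.fst)))
    have c3 : Partrec₂ fun (y : Nat.Partrec.Code × ((ℕ × ℕ) × ℕ)) (m : ℕ) =>
        S (y.1, ((y.2.1.1, m), y.2.2)) := hS.comp c2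
    have c4 := Partrec.nat_casesOn_right c0 c1 c3
    exact c4
  have hG' : Partrec₂ fun (c : Nat.Partrec.Code) (n : ℕ) =>
      ((Encodable.decode (α := (ℕ × ℕ) × ℕ) n : Part ((ℕ × ℕ) × ℕ)).bind fun x =>
        (G c x).map Encodable.encode) := by
    have h1 : Partrec fun y : Nat.Partrec.Code × ℕ =>
        (Encodable.decode (α := (ℕ × ℕ) × ℕ) y.2 : Part ((ℕ × ℕ) × ℕ)) :=
      Computable.ofOption (Computable.decode.comp Computable.snd)
    have h2 : Partrec fun z : (Nat.Partrec.Code × ℕ) × ((ℕ × ℕ) × ℕ) => G z.1.1 z.2 :=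
      hG.comp (Computable.fst.comp Computable.fst) Computable.snd
    have h3 : Partrec fun z : (Nat.Partrec.Code × ℕ) × ((ℕ × ℕ) × ℕ) =>
        (G z.1.1 z.2).map Encodable.encode :=
      h2.map (Computable.encode.comp Computable.snd).to₂
    exact h1.bind h3.to₂
  -- The search for a predecessor must run the chain function itself one level below; the recursion
  -- theorem supplies a code that refers to itself. Single-valuedness then makes initial segments of
  -- chosen chains chosen.
  obtain ⟨c, hc⟩ := Nat.Partrec.Code.fixed_point₂ hG'
  have hfix : ∀ x, E c x = G c x := fun x => by
    refine Part.ext fun l => ?_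
    simp only [E, congrFun hc, Encodable.encodek, Part.mem_bind_iff, Part.coe_some,
      Part.bind_some, Part.mem_map_iff]
    constructor
    · rintro ⟨n, ⟨l', hl', rfl⟩, hl⟩
      rw [Encodable.encodek] at hl
      simp only [Part.coe_some, Part.mem_some_iff] at hl
      exact hl ▸ hl'
    · exact fun hl => ⟨_, ⟨l, hl, rfl⟩, by simp⟩
  refine ⟨E c, hE.comp (Computable.const c) Computable.id, fun b p l => ?_, fun b m p l hl => ?_,
    fun b m p p' hp' hR' => ?_⟩
  · rw [hfix]
    simp [G]
  · rw [hfix] at hl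
    obtain ⟨p', hp'⟩ := hS1 _ _ hl
    obtain ⟨hR', hp'⟩ := Part.mem_assert_iff.1 hp'
    obtain ⟨l', hl', rfl⟩ := (Part.mem_map_iff _).1 hp'
    exact ⟨p', l', hl', hR', rfl⟩
  · rw [hfix]
    exact hS2 (c, ((b, m), p)) p' ⟨hR', hp'⟩

end ChainFunction

/-! ### Complexity bounds and a Solovay function -/

section Complexity

variable {U : List Bool →. List Bool}

theorem prefixComplexity_le {σ y : List Bool} (h : y ∈ U σ) : prefixComplexity U y ≤ σ.length :=
  Nat.sInf_le ⟨σ, h, rfl⟩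

/-- A machine that reads the number `d` as `1ᵈ0` and a description `σ` for `U`. -/
theorem IsOptimalPrefixFreeMachine.exists_prefixComplexity_le (hU : IsOptimalPrefixFreeMachine U)
    {G : List Bool × ℕ →. List Bool} (hG : Partrec G) (hdom : ∀ σ d, (G (σ, d)).Dom → (U σ).Dom) :
    ∃ c, ∀ σ d, ∀ y ∈ G (σ, d), prefixComplexity U y ≤ σ.length + d + c := by
  let I : List Bool → ℕ := List.idxOf false
  have hI : Computable I :=
    (Primrec.list_idxOf.comp (Primrec.const false) Primrec.id).to_comp
  let L : List Bool →. List Bool := fun τ =>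
    Part.assert (I τ < τ.length) fun _ => G (τ.drop (I τ + 1), I τ)
  have hL : IsPrefixFreeMachine L := by
    constructor
    · refine Partrec.assert (hG.comp (Computable.pair ?_ hI)) ?_
      · exact Primrec.list_drop.to_comp.comp (Computable.succ.comp hI) Computable.id
      · exact (PrimrecPred.computablePred (Primrec.nat_lt.comp
          (Primrec.list_idxOf.comp (Primrec.const false) Primrec.id) Primrec.list_length)).to_re
    · rintro τ _ ⟨h1, h1'⟩ ⟨h2, h2'⟩ ⟨ρ, rfl⟩
      -- Comparable inputs share the header `1ᵈ0`, so their remainders are comparable elements of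
      -- the domain of `U`.
      have hmem : false ∈ τ := List.idxOf_lt_length_iff.1 h1
      have hidx : I (τ ++ ρ) = I τ := List.idxOf_append_of_mem hmem
      have h3 := hU.1.2 _ _ (hdom _ _ h1') (hdom _ _ h2') (by
        rw [hidx, List.drop_append_of_le_length (by exact h1)]
        exact List.prefix_append _ _)
      rw [hidx, List.drop_append_of_le_length (by exact h1)] at h3
      simpa using h3
  obtain ⟨e, he⟩ := hU.2 L hL
  refine ⟨e + 1, fun σ d y hy => ?_⟩
  have hidx : I (List.replicate d true ++ false :: σ) = d := by
    simp only [I]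
    rw [List.idxOf_append_of_notMem (by simp)]
    simp
  have hmem : y ∈ L (List.replicate d true ++ false :: σ) := by
    simp only [L, hidx, Part.mem_assert_iff]
    refine ⟨by simp, ?_⟩
    simpa [List.drop_append] using hy
  obtain ⟨τ, hτ, hlen⟩ := he _ _ hmem
  have := prefixComplexity_le hτ
  simp at hlen
  omega

theorem IsOptimalPrefixFreeMachine.exists_prefixComplexity_comp_le
    (hU : IsOptimalPrefixFreeMachine U) {g : List Bool →. List Bool} (hg : Partrec g) :
    ∃ c, ∀ y, ∀ z ∈ g y, prefixComplexity U z ≤ prefixComplexity U y + c := by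
  obtain ⟨c, hc⟩ := hU.exists_prefixComplexity_le (G := fun x => (U x.1).bind g)
    ((hU.1.1.comp Computable.fst).bind (hg.comp Computable.snd).to₂) fun σ d h => h.fst
  refine ⟨c, fun y z hz => ?_⟩
  obtain ⟨σ, hσ, hlen⟩ := hU.exists_description y
  have := hc σ 0 z (Part.mem_bind hσ hz)
  omega

variable {code : List ℕ → List Bool}

theorem IsOptimalPrefixFreeMachine.exists_tupleComplexity_comp_le
    (hU : IsOptimalPrefixFreeMachine U) (hcode : IsEffectiveEncoding code)
    {g : List ℕ → List ℕ} (hg : Computable g) :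
    ∃ c, ∀ l, tupleComplexity U code (g l) ≤ tupleComplexity U code l + c := by
  obtain ⟨dec, hdec, h⟩ := hcode.1.exists_partrec_leftInverse hcode.2
  obtain ⟨c, hc⟩ := hU.exists_prefixComplexity_comp_le
    (hdec.map (hcode.1.comp (hg.comp Computable.snd)).to₂)
  exact ⟨c, fun l => hc _ _ (Part.mem_map _ ((h l l).2 rfl))⟩

/-- A computable upper bound `f` for the complexity of numbers `m + k`, for which every number `n`
has a code `m ≥ n` such that `f m` is the complexity of `0ⁿ` (a Solovay function). -/
theorem IsOptimalPrefixFreeMachine.exists_solovay_function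
    (hU : IsOptimalPrefixFreeMachine U) (hcode : IsEffectiveEncoding code) (k : ℕ) :
    ∃ (f g : ℕ → ℕ) (c : ℕ), Computable f ∧ Computable g ∧
      (∀ m, tupleComplexity U code [m + k] ≤ f m + c) ∧ (∀ m, g m ≤ m) ∧
      ∀ n, ∃ m, g m = n ∧ f m = prefixComplexity U (List.replicate n false) := by
  have hrep : Computable fun n : ℕ => List.replicate n false :=
    ((Primrec.list_map Primrec.list_range (Primrec.const false).to₂).of_eq fun n => by
      simp [List.map_const']).to_comp
  have hP : Partrec fun x : List Bool × ℕ =>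
      Part.assert (List.replicate x.2 false ∈ U x.1) fun _ => Part.some () :=
    hU.1.1.mem_re.comp (Computable.fst.pair (hrep.comp Computable.snd))
  obtain ⟨t, ht, ht1, ht2⟩ := hP.exists_stage
  let s : ℕ → List Bool := fun m => (Encodable.decode (α := List Bool) m.unpair.2.unpair.1).getD []
  have hs : Computable s := Computable.option_getD (Computable.decode.comp
    (Computable.fst.comp (Computable.unpair.comp (Computable.snd.comp Computable.unpair))))
    (Computable.const [])
  -- A valid `m` codes `n`, a description `σ` of `0ⁿ` and its unique stage, so `σ` alone determines
  -- `m`. The test on `encode` rejects numbers that do not properly code a string. Invalid `m` get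
  -- the unary bound `m`.
  let f : ℕ → ℕ := fun m =>
    bif t ((s m, m.unpair.1), m.unpair.2.unpair.2) &&
      decide (Encodable.encode (s m) = m.unpair.2.unpair.1) then (s m).length else m
  have hf : Computable f := by
    have h1 : Computable fun m : ℕ => m.unpair.2.unpair :=
      Computable.unpair.comp (Computable.snd.comp Computable.unpair)
    have h2 : Computable₂ fun a b : ℕ => decide (a = b) := Primrec.eq.decide.to_comp
    exact Computable.cond (Primrec.and.to_comp.comp
      (ht.comp ((hs.pair (Computable.fst.comp Computable.unpair)).pair (Computable.snd.comp h1)))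
      (h2.comp (Computable.encode.comp hs) (Computable.fst.comp h1)))
      (Computable.list_length.comp hs) Computable.id
  have hsing : Computable fun n : ℕ => code [n + k] :=
    hcode.1.comp (Computable.list_cons.comp
      (Primrec.nat_add.comp Primrec.id (Primrec.const k)).to_comp (Computable.const []))
  obtain ⟨c₁, hc₁⟩ := hU.exists_prefixComplexity_le
    (G := fun x => (U x.1).bind fun _ => Part.some (code [x.2 + k]))
    ((hU.1.1.comp Computable.fst).bind
      (hsing.comp (Computable.snd.comp Computable.fst)).partrec.to₂) fun σ d h => h.fst
  obtain ⟨σ₀, hσ₀, -⟩ := hU.exists_description []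
  -- recover the code of `n` from its description and the stage of convergence
  let H : List Bool × ℕ →. ℕ := fun x => (U x.1).bind fun y =>
    (Nat.rfind fun j => Part.some (t ((x.1, y.length), j))).map fun j =>
      Nat.pair y.length (Nat.pair (Encodable.encode x.1) j)
  have hH : Partrec H := by
    have h1 : Partrec₂ fun (z : (List Bool × ℕ) × List Bool) (j : ℕ) =>
        Part.some (t ((z.1.1, z.2.length), j)) := (ht.comp ((((Computable.fst.comp Computable.fst).comp Computable.fst).pair
        (Computable.list_length.comp (Computable.snd.comp Computable.fst))).pair
        Computable.snd)).partrec.to₂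
    have hpair : Computable₂ Nat.pair := Primrec₂.natPair.to_comp
    have h2 : Computable₂ fun (z : (List Bool × ℕ) × List Bool) (j : ℕ) =>
        Nat.pair z.2.length (Nat.pair (Encodable.encode z.1.1) j) := (hpair.comp (Computable.list_length.comp (Computable.snd.comp Computable.fst))
        (hpair.comp (Computable.encode.comp (Computable.fst.comp (Computable.fst.comp
          Computable.fst))) Computable.snd)).to₂
    exact (hU.1.1.comp Computable.fst).bind ((Partrec.rfind h1).map h2).to₂
  obtain ⟨c₂, hc₂⟩ := hU.exists_prefixComplexity_le
    (G := fun x => (H x).map fun m => code [m + k])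
    (hH.map (hsing.comp Computable.snd).to₂) fun σ d h => h.fst
  refine ⟨f, fun m => m.unpair.1, σ₀.length + c₁ + c₂, hf, Computable.fst.comp Computable.unpair,
    fun m => ?_, Nat.unpair_left_le, fun n => ?_⟩
  · unfold tupleComplexity
    by_cases h : t ((s m, m.unpair.1), m.unpair.2.unpair.2) = true ∧
        Encodable.encode (s m) = m.unpair.2.unpair.1
    · have hfm : f m = (s m).length := by simp [f, h.1, h.2]
      have hU' : List.replicate m.unpair.1 false ∈ U (s m) := ((ht1 _).2 ⟨_, h.1⟩).fst
      have hm : m ∈ H (s m, 0) := by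
        refine Part.mem_bind hU' ((Part.mem_map_iff _).2 ⟨m.unpair.2.unpair.2, ?_, ?_⟩)
        · rw [List.length_replicate]
          refine Nat.mem_rfind.2 ⟨Part.mem_some_iff.2 h.1.symm, fun {j} hj => ?_⟩
          refine Part.mem_some_iff.2 ?_
          by_contra hne
          exact hj.ne (ht2 _ _ _ (by simpa using hne) h.1)
        · simp [h.2]
      have := hc₂ _ _ _ (Part.mem_map (fun m => code [m + k]) hm)
      omega
    · have hfm : f m = m := by
        have : (t ((s m, m.unpair.1), m.unpair.2.unpair.2) &&
            decide (Encodable.encode (s m) = m.unpair.2.unpair.1)) = false := by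
          simpa [← Bool.not_eq_true] using h
        simp only [f, this, cond_false]
      have := hc₁ σ₀ m _ (Part.mem_bind hσ₀ (Part.mem_some _))
      simp only at this
      omega
  · obtain ⟨σ, hσ, hlen⟩ := hU.exists_description (List.replicate n false)
    obtain ⟨j, hj⟩ := (ht1 (σ, n)).1 ⟨hσ, trivial⟩
    exact ⟨Nat.pair n (Nat.pair (Encodable.encode σ) j), by simp, by simp [f, s, hj, hlen]⟩

end Complexity

/-! ### Enumerating strict upper bounds on distances -/

section ComputableMetric

theorem IsRealCauchyName.abs_sub_le {r : ℕ → ℚ} {z : ℝ} (h : IsRealCauchyName r z) (n : ℕ) :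
    |(r n : ℝ) - z| ≤ (1 / 2) ^ n := by
  have h1 : ∀ n, dist (r n : ℝ) (r (n + 1)) ≤ 1 / 2 / 2 ^ n := fun n => by
    have := (Rat.cast_le (K := ℝ)).2 (h.1 n)
    rw [dist_comm, Real.dist_eq, div_div, ← pow_succ', ← one_div_pow]
    push_cast at this
    exact this
  have := dist_le_of_le_geometric_two_of_tendsto h1 h.2 n
  rwa [Real.dist_eq, ← one_div_pow] at this

theorem IsRealCauchyName.lt_iff {r : ℕ → ℚ} {z : ℝ} (h : IsRealCauchyName r z) (m : ℕ) :
    z < (1 / 2) ^ m ↔ ∃ n, r n + (1 / 2) ^ n < (1 / 2 : ℚ) ^ m := by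
  constructor
  · intro hz
    obtain ⟨n, hn⟩ := exists_pow_lt_of_lt_one (half_pos (sub_pos.2 hz)) (one_half_lt_one (α := ℝ))
    have := abs_le.1 (h.abs_sub_le n)
    refine ⟨n, ?_⟩
    have h2 : (r n : ℝ) + (1 / 2) ^ n < (1 / 2) ^ m := by linarith [this.2]
    rw [← Rat.cast_lt (K := ℝ)]
    push_cast
    exact h2
  · rintro ⟨n, hn⟩
    have := abs_le.1 (h.abs_sub_le n)
    have h2 : (r n : ℝ) + (1 / 2) ^ n < (1 / 2) ^ m := by
      have := (Rat.cast_lt (K := ℝ)).2 hn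
      push_cast at this
      exact this
    linarith [this.1]

/-- Clearing denominators turns the rational test into natural number arithmetic, where
computability is immediate. -/
theorem div_add_pow_lt_pow_iff (u v w n m : ℕ) :
    ((u : ℚ) - v) / (w + 1) + (1 / 2) ^ n < (1 / 2) ^ m ↔
      u * 2 ^ n * 2 ^ m + (w + 1) * 2 ^ m < (w + 1) * 2 ^ n + v * 2 ^ n * 2 ^ m := by
  rw [← @Nat.cast_lt ℚ]
  push_cast
  have hw : (0 : ℚ) < w + 1 := by positivity
  rw [one_div_pow, one_div_pow, div_add_div _ _ hw.ne' (by positivity),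
    div_lt_div_iff₀ (by positivity) (by positivity), ← sub_pos, ← sub_pos (b := _ + _)]
  ring_nf

theorem IsUniformlyComputableReal.lt_pow_re {ι : Type*} [Primcodable ι] {z : ι → ℝ}
    (h : IsUniformlyComputableReal z) : REPred fun x : ι × ℕ => z x.1 < (1 / 2) ^ x.2 := by
  obtain ⟨u, v, w, hu, hv, hw, h⟩ := h
  have hadd : Computable₂ fun a b : ℕ => a + b := Primrec.nat_add.to_comp
  have hmul : Computable₂ fun a b : ℕ => a * b := Primrec.nat_mul.to_comp
  have hlt : Computable₂ fun a b : ℕ => decide (a < b) := Primrec.nat_lt.decide.to_comp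
  have hpow : Computable fun n : ℕ => 2 ^ n :=
    (Computable.nat_rec Computable.id (Computable.const 1)
      (hmul.comp (Computable.snd.comp Computable.snd) (Computable.const 2)).to₂).of_eq fun n => by
        induction n with
        | zero => rfl
        | succ n ih => simp_all [pow_succ]
  have ci : Computable fun y : (ι × ℕ) × ℕ => y.1.1 := Computable.fst.comp Computable.fst
  have cu := hu.comp ci Computable.snd
  have cv := hv.comp ci Computable.snd
  have cw := Computable.succ.comp (hw.comp ci Computable.snd)
  have cn : Computable fun y : (ι × ℕ) × ℕ => 2 ^ y.2 := hpow.comp Computable.snd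
  have cm : Computable fun y : (ι × ℕ) × ℕ => 2 ^ y.1.2 :=
    hpow.comp (Computable.snd.comp Computable.fst)
  have hre := REPred.exists (ComputablePred.to_re (Computable.computablePred
    (hlt.comp
      (hadd.comp (hmul.comp (hmul.comp cu cn) cm) (hmul.comp cw cm))
      (hadd.comp (hmul.comp cw cn) (hmul.comp (hmul.comp cv cn) cm)))))
  refine hre.of_eq fun x => ?_
  rw [(h x.1).lt_iff]
  exact exists_congr fun n => (div_add_pow_lt_pow_iff _ _ _ _ _).symm

end ComputableMetric

/-! ### Paths through trees with finite levels -/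

section Koenig

/-- Kőnig's lemma for trees of tuples, given by their finite nonempty levels. -/
theorem exists_path_of_finite_levels {α : Type*} [Inhabited α] (T : ℕ → Set (List α))
    (hlen : ∀ m, ∀ l ∈ T m, l.length = m + 1) (hfin : ∀ m, (T m).Finite)
    (hne : ∀ m, (T m).Nonempty) (htake : ∀ m, ∀ l ∈ T (m + 1), l.take (m + 1) ∈ T m) :
    ∃ h : ℕ → α, ∀ m, (List.range (m + 1)).map h ∈ T m := by
  have htake' : ∀ i j, i ≤ j → ∀ l ∈ T j, l.take (i + 1) ∈ T i := by
    intro i j hij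
    induction j, hij using Nat.le_induction with
    | base => exact fun l hl => by rwa [List.take_of_length_le (hlen i l hl).le]
    | succ j hij ih =>
      intro l hl
      have := ih _ (htake j l hl)
      rwa [List.take_take, min_eq_left (by omega)] at this
  have : ∀ m, Finite (T m) := fun m => hfin m
  have : ∀ m, Nonempty (T m) := fun m => (hne m).to_subtype
  obtain ⟨g, hg⟩ := exists_seq_forall_proj_of_forall_finite (α := fun m => T m)
    (fun {i j} hij l => ⟨l.1.take (i + 1), htake' i j hij l.1 l.2⟩)
    (fun i l => Subtype.ext (List.take_of_length_le (hlen i l.1 l.2).le))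
    (fun i j k hij hjk l => Subtype.ext (by
      simp only [List.take_take]
      rw [min_eq_left (by omega)]))
    (fun i a => Set.toFinite _)
  -- The tuple `g i` has length `i + 1`, so this is its last entry and the default is never used.
  obtain ⟨h, hh⟩ : ∃ h : ℕ → α, ∀ i, h i = (g i).1.getD i default := ⟨_, fun _ => rfl⟩
  refine ⟨h, fun m => ?_⟩
  convert! (g m).2
  refine List.ext_getElem (by simp [hlen m _ (g m).2]) fun i h1 h2 => ?_
  have hi : i ≤ m := by simp at h1; omega
  have := congrArg Subtype.val (hg hi)
  simp only at this
  rw [List.getElem_map, List.getElem_range, hh, ← this]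
  simp [List.getD_eq_getElem?_getD, h2]

end Koenig

/-! ### The two implications -/

section KTrivial

variable {U : List Bool →. List Bool} {code : List ℕ → List Bool}

/-- There are finitely many short strings, and each describes at most one output. This keeps the
levels of the tree finite. -/
theorem finite_setOf_description_length_le {ι : Type*} {y : ι → List Bool}
    (hy : Function.Injective y) (N : ℕ) :
    {i | ∃ σ : List Bool, y i ∈ U σ ∧ σ.length ≤ N}.Finite := by
  have h1 : {z | ∃ σ : List Bool, z ∈ U σ ∧ σ.length ≤ N}.Finite := by
    refine ((List.finite_length_le Bool N).biUnion
      (t := fun σ => {z | z ∈ U σ}) fun σ _ => ?_).subset ?_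
    · exact Set.Subsingleton.finite fun a ha b hb => Part.mem_unique ha hb
    · rintro z ⟨σ, hσ, hlen⟩
      exact Set.mem_biUnion (x := σ) hlen hσ
  exact Set.Finite.preimage (f := y) hy.injOn h1

/-- Values of a partial recursive function of `(b, m, p)` need no more than a description of
`(p, m + k)` of length at most `f m + b`, when `f` is computable. -/
theorem IsOptimalPrefixFreeMachine.exists_tupleComplexity_le_of_description
    (hU : IsOptimalPrefixFreeMachine U) (hcode : IsEffectiveEncoding code)
    {F : (ℕ × ℕ) × ℕ →. List ℕ} (hF : Partrec F) {f : ℕ → ℕ} (hf : Computable f) (k : ℕ) :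
    ∃ c, ∀ b m p, ∀ l ∈ F ((b, m), p),
      (∃ σ : List Bool, code [p, m + k] ∈ U σ ∧ σ.length ≤ f m + b) →
        tupleComplexity U code l ≤ f m + b + c := by
  obtain ⟨dec, hdec, h⟩ := hcode.1.exists_partrec_leftInverse hcode.2
  let M : List ℕ → ℕ := fun l => l.getD 1 0 - k
  have hget : ∀ i, Computable fun l : List ℕ => l.getD i 0 := fun i =>
    ((Primrec.list_getD 0).comp Primrec.id (Primrec.const i)).to_comp
  have hsub : Computable₂ fun a b : ℕ => a - b := Primrec.nat_sub.to_comp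
  have hadd : Computable₂ fun a b : ℕ => a + b := Primrec.nat_add.to_comp
  have hM : Computable M := hsub.comp (hget 1) (Computable.const k)
  -- The padding `d = f m + b - |σ|` lets `b` be read off as `|σ| + d - f m`, so `b` needs no
  -- description of its own.
  let A : (List Bool × ℕ) × List ℕ → (ℕ × ℕ) × ℕ := fun x =>
    ((x.1.1.length + x.1.2 - f (M x.2), M x.2), x.2.getD 0 0)
  have hA : Computable A := by
    have h1 : Computable fun x : (List Bool × ℕ) × List ℕ => x.1.1.length + x.1.2 :=
      hadd.comp (Computable.list_length.comp (Computable.fst.comp Computable.fst))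
        (Computable.snd.comp Computable.fst)
    exact ((hsub.comp h1 (hf.comp (hM.comp Computable.snd))).pair
      (hM.comp Computable.snd)).pair ((hget 0).comp Computable.snd)
  let G : List Bool × ℕ →. List Bool := fun x =>
    ((U x.1).bind dec).bind fun l => (F (A (x, l))).map code
  have hG : Partrec G :=
    ((hU.1.1.comp Computable.fst).bind (hdec.comp Computable.snd).to₂).bind
      ((hF.comp hA).map (hcode.1.comp Computable.snd).to₂).to₂
  obtain ⟨c, hc⟩ := hU.exists_prefixComplexity_le hG fun σ d h => h.fst.fst
  refine ⟨c, fun b m p l hl => ?_⟩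
  rintro ⟨σ, hσ, hlen⟩
  have hmem : code l ∈ G (σ, f m + b - σ.length) := by
    refine Part.mem_bind (Part.mem_bind hσ ((h _ _).2 rfl)) (Part.mem_map _ ?_)
    have : A ((σ, f m + b - σ.length), [p, m + k]) = ((b, m), p) := by
      simp [A, M]
      omega
    rwa [this]
  have := hc _ _ _ hmem
  unfold tupleComplexity
  omega

variable {M : Type*} [MetricSpace M] {q : ℕ → M}

theorem isCauchyName_of_dist_le {h : ℕ → ℕ} {x : M}
    (hx : ∀ m, dist (q (h m)) x ≤ (1 / 2 : ℝ) ^ (m + 1)) : IsCauchyName q h x := by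
  constructor
  · intro s t hst
    have h1 : (1 / 2 : ℝ) ^ (t + 1) ≤ (1 / 2) ^ (s + 1) :=
      pow_le_pow_of_le_one (by norm_num) (by norm_num) (by omega)
    have h2 := dist_triangle_right (q (h s)) (q (h t)) x
    have h3 : (1 / 2 : ℝ) ^ s = (1 / 2) ^ (s + 1) + (1 / 2) ^ (s + 1) := by ring
    linarith [hx s, hx t]
  · rw [tendsto_iff_dist_tendsto_zero]
    refine squeeze_zero (fun _ => dist_nonneg) hx ?_
    exact (tendsto_pow_atTop_nhds_zero_of_lt_one (by norm_num) (by norm_num)).comp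
      (tendsto_add_atTop_nat 1)

theorem IsCauchyName.dist_le {α : ℕ → ℕ} {x : M} (h : IsCauchyName q α x) (s : ℕ) :
    dist x (q (α s)) ≤ (1 / 2 : ℝ) ^ s := by
  rw [dist_comm]
  exact le_of_tendsto (tendsto_const_nhds.dist h.2)
    (eventually_atTop.2 ⟨s, fun t ht => h.1 s t ht⟩)

theorem IsOptimalPrefixFreeMachine.exists_isKTrivialVia_of_isLocallyKTrivialVia
    (hU : IsOptimalPrefixFreeMachine U) (hcode : IsEffectiveEncoding code)
    (hq : IsComputableMetricSpace q) :
    ∃ c : ℕ, ∀ (b : ℕ) (x : M), IsLocallyKTrivialVia U code q x b →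
      ∃ h : ℕ → ℕ, IsCauchyName q h x ∧ IsKTrivialVia U code h (b + c) := by
  obtain ⟨f, g, c₀, hf, hg, hf', hg', hfg⟩ := hU.exists_solovay_function hcode 3
  let Q : (ℕ × ℕ) × ℕ → Prop := fun y =>
    ∃ σ : List Bool, code [y.2, y.1.2 + 3] ∈ U σ ∧ σ.length ≤ f y.1.2 + y.1.1
  have hQ : REPred Q := by
    have hadd : Computable₂ fun a b : ℕ => a + b := Primrec.nat_add.to_comp
    have hle : Computable₂ fun a b : ℕ => decide (a ≤ b) := Primrec.nat_le.decide.to_comp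
    have c1 : Computable fun y : ((ℕ × ℕ) × ℕ) × List Bool => y.1.1.2 :=
      Computable.snd.comp (Computable.fst.comp Computable.fst)
    have c2 : Computable fun y : ((ℕ × ℕ) × ℕ) × List Bool => y.1.1.2 + 3 :=
      hadd.comp c1 (Computable.const 3)
    have c3 : Computable fun y : ((ℕ × ℕ) × ℕ) × List Bool => [y.1.2, y.1.1.2 + 3] :=
      Computable.list_cons.comp (Computable.snd.comp Computable.fst)
        (Computable.list_cons.comp c2 (Computable.const []))
    have h1 : REPred fun y : ((ℕ × ℕ) × ℕ) × List Bool => code [y.1.2, y.1.1.2 + 3] ∈ U y.2 :=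
      REPred.comp (p := fun z : List Bool × List Bool => z.2 ∈ U z.1) (Partrec.mem_re hU.1.1)
        (f := fun y : ((ℕ × ℕ) × ℕ) × List Bool => (y.2, code [y.1.2, y.1.1.2 + 3]))
        (Computable.pair Computable.snd (hcode.1.comp c3))
    have h2 : REPred fun y : ((ℕ × ℕ) × ℕ) × List Bool => y.2.length ≤ f y.1.1.2 + y.1.1.1 :=
      (Computable.computablePred (hle.comp (Computable.list_length.comp Computable.snd)
        (hadd.comp (hf.comp c1)
          (Computable.fst.comp (Computable.fst.comp Computable.fst))))).to_re
    exact (h1.and h2).exists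
  -- Only the predecessor is tested for low complexity here; the end point is tested in `T`.
  have hR : REPred fun y : ((ℕ × ℕ) × ℕ) × ℕ =>
      Q y.1 ∧ dist (q y.1.2) (q y.2) < (1 / 2 : ℝ) ^ (y.1.1.2 + 2) := by
    refine (hQ.comp Computable.fst).and (hq.computable_dist.lt_pow_re.comp
      (f := fun y : ((ℕ × ℕ) × ℕ) × ℕ => ((y.1.2, y.2), y.1.1.2 + 2)) ?_)
    exact ((Computable.snd.comp Computable.fst).pair Computable.snd).pair
      (Computable.succ.comp (Computable.succ.comp
        (Computable.snd.comp (Computable.fst.comp Computable.fst))))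
  obtain ⟨F, hF, hF0, hFs, hFd⟩ := hR.exists_chain
  obtain ⟨c₁, hc₁⟩ := hU.exists_tupleComplexity_le_of_description hcode hF hf 3
  obtain ⟨c₂, hc₂⟩ := hU.exists_tupleComplexity_comp_le hcode
    (g := fun l => l.take (g (l.length - 1)))
    (Primrec.list_take.to_comp.comp
      (hg.comp (Computable.pred.comp Computable.list_length)) Computable.id)
  refine ⟨c₀ + c₁ + c₂, fun b x hx => ?_⟩
  -- As `f` bounds `K(m + 3)` only up to `c₀`, the parameter becomes `b + c₀`.
  have hpt : ∀ m, ∃ p, dist x (q p) < (1 / 2 : ℝ) ^ (m + 3) ∧ Q ((b + c₀, m), p) := fun m => by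
    obtain ⟨p, hp, hK⟩ := hx (m + 3)
    obtain ⟨σ, hσ, hlen⟩ := hU.exists_description (code [p, m + 3])
    refine ⟨p, hp, σ, hσ, ?_⟩
    have := hf' m
    simp only [tupleComplexity] at hK this ⊢
    omega
  choose p hp hpQ using hpt
  have hdom : ∀ m, (F ((b + c₀, m), p m)).Dom := by
    intro m
    induction m with
    | zero => exact Part.dom_iff_mem.2 ⟨_, (hF0 _ _ _).2 rfl⟩
    | succ m ih =>
      -- The shift by `3` brings consecutive witnesses within the required `2⁻⁽ᵐ⁺²⁾` of each other.
      refine hFd _ _ _ _ ih ⟨hpQ m, ?_⟩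
      have h1 := dist_triangle_left (q (p m)) (q (p (m + 1))) x
      have h2 : (1 / 2 : ℝ) ^ (m + 1 + 3) ≤ (1 / 2) ^ (m + 3) :=
        pow_le_pow_of_le_one (by norm_num) (by norm_num) (by omega)
      have h3 : (1 / 2 : ℝ) ^ (m + 2) = (1 / 2) ^ (m + 3) + (1 / 2) ^ (m + 3) := by ring
      simp only
      linarith [hp m, hp (m + 1)]
  have hlen : ∀ m p, ∀ l ∈ F ((b + c₀, m), p), l.length = m + 1 ∧ l.getD m 0 = p := by
    intro m
    induction m with
    | zero =>
      intro p l hl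
      simp [(hF0 _ _ _).1 hl]
    | succ m ih =>
      intro p l hl
      obtain ⟨p', l', hl', -, rfl⟩ := hFs _ _ _ _ hl
      have := (ih p' l' hl').1
      simp [← this]
  -- The radius `2⁻⁽ᵐ⁺¹⁾` makes `T` closed under truncation: an end point within `2⁻⁽ᵐ⁺²⁾` of `x`
  -- and a step below `2⁻⁽ᵐ⁺²⁾` put the predecessor within `2⁻⁽ᵐ⁺¹⁾`.
  let T : ℕ → Set (List ℕ) := fun m => {l | ∃ p, l ∈ F ((b + c₀, m), p) ∧ Q ((b + c₀, m), p) ∧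
    dist (q p) x ≤ (1 / 2 : ℝ) ^ (m + 1)}
  obtain ⟨h, hh⟩ := exists_path_of_finite_levels T
    (fun m l ⟨p, hl, _⟩ => (hlen m p l hl).1)
    (fun m => by
      have hinj : Function.Injective fun p : ℕ => code [p, m + 3] := fun p p' hpp => by
        simpa using hcode.2 hpp
      refine ((finite_setOf_description_length_le (U := U) hinj (f m + (b + c₀))).biUnion
        (t := fun p => {l | l ∈ F ((b + c₀, m), p)}) fun p _ => ?_).subset ?_
      · exact Set.Subsingleton.finite fun a ha b hb => Part.mem_unique ha hb
      · rintro l ⟨p, hl, hQp, -⟩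
        exact Set.mem_biUnion (x := p) hQp hl)
    (fun m => by
      obtain ⟨l, hl⟩ := Part.dom_iff_mem.1 (hdom m)
      refine ⟨l, p m, hl, hpQ m, ?_⟩
      rw [dist_comm]
      exact (hp m).le.trans (pow_le_pow_of_le_one (by norm_num) (by norm_num) (by omega)))
    (fun m l ⟨p, hl, _, hd⟩ => by
      obtain ⟨p', l', hl', ⟨hQ', hd'⟩, rfl⟩ := hFs _ _ _ _ hl
      refine ⟨p', ?_, hQ', ?_⟩
      · rwa [List.take_left' (hlen m p' l' hl').1]
      · have h1 := dist_triangle (q p') (q p) x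
        have h3 : (1 / 2 : ℝ) ^ (m + 1) = (1 / 2) ^ (m + 2) + (1 / 2) ^ (m + 2) := by ring
        simp only at hd'
        linarith)
  refine ⟨h, isCauchyName_of_dist_le fun m => ?_, fun n => ?_⟩
  · obtain ⟨p, hl, -, hd⟩ := hh m
    have := (hlen m p _ hl).2
    rw [List.getD_eq_getElem?_getD] at this
    simp only [List.getElem?_map, List.getElem?_range (Nat.lt_succ_self m), Option.map_some,
      Option.getD_some] at this
    rwa [this]
  -- At this `m` the bound `f m` is exactly `K(0ⁿ)`, and `n = g m` is computable from the length `m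
  -- + 1`, so truncation costs a constant.
  · obtain ⟨m, hgm, hfm⟩ := hfg n
    obtain ⟨p, hl, hQp, -⟩ := hh m
    have h1 := hc₁ _ _ _ _ hl hQp
    have h2 := hc₂ ((List.range (m + 1)).map h)
    have hnm : n ≤ m := hgm ▸ hg' m
    have h3 : ((List.range (m + 1)).map h).take (g (((List.range (m + 1)).map h).length - 1)) =
        (List.range n).map h := by
      rw [List.length_map, List.length_range, Nat.add_sub_cancel, hgm, ← List.map_take,
        List.take_range, min_eq_left (by omega)]
    rw [h3] at h2
    omega

theorem IsOptimalPrefixFreeMachine.exists_isLocallyKTrivialVia_of_isKTrivialVia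
    (hU : IsOptimalPrefixFreeMachine U) (hcode : IsEffectiveEncoding code) :
    ∃ c : ℕ, ∀ (v : ℕ) (x : M) (f : ℕ → ℕ), IsCauchyName q f x → IsKTrivialVia U code f v →
      IsLocallyKTrivialVia U code q x (v + c) := by
  have hget : Computable fun l : List ℕ => l.getD (l.length - 1) 0 :=
    ((Primrec.list_getD 0).comp Primrec.id (Primrec.pred.comp Primrec.list_length)).to_comp
  -- Applied to the name restricted to `n + 2`: the last entry has index `n + 1`, whose error
  -- `2⁻⁽ⁿ⁺¹⁾` is strictly below `2⁻ⁿ`.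
  have hg : Computable fun l : List ℕ => [l.getD (l.length - 1) 0, l.length - 2] :=
    Computable.list_cons.comp hget (Computable.list_cons.comp
      (Computable.pred.comp (Computable.pred.comp Computable.list_length)) (Computable.const []))
  obtain ⟨c₁, hc₁⟩ := hU.exists_tupleComplexity_comp_le hcode hg
  obtain ⟨dec, hdec, h⟩ := hcode.1.exists_partrec_leftInverse hcode.2
  have hz : Computable fun l : List ℕ => List.replicate (l.getD 0 0 + 2) false :=
    ((Primrec.list_map (Primrec.list_range.comp (Primrec.succ.comp (Primrec.succ.comp
      ((Primrec.list_getD 0).comp Primrec.id (Primrec.const 0))))) (Primrec.const false).to₂).of_eq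
      fun l => by simp [List.map_const']).to_comp
  obtain ⟨c₂, hc₂⟩ := hU.exists_prefixComplexity_comp_le
    (hdec.map (hz.comp Computable.snd).to₂)
  refine ⟨c₁ + c₂, fun v x f hf hK n => ⟨f (n + 1), ?_, ?_⟩⟩
  · exact (hf.dist_le (n + 1)).trans_lt
      (pow_lt_pow_right_of_lt_one₀ (by norm_num) (by norm_num) (by omega))
  · have h1 := hc₁ ((List.range (n + 2)).map f)
    have h2 := hc₂ _ _ (Part.mem_map (fun l : List ℕ => List.replicate (l.getD 0 0 + 2) false)
      ((h [n] [n]).2 rfl))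
    have h3 := hK (n + 2)
    have h4 : [((List.range (n + 2)).map f).getD (((List.range (n + 2)).map f).length - 1) 0,
        ((List.range (n + 2)).map f).length - 2] = [f (n + 1), n] := by
      simp [List.getD_eq_getElem?_getD]
    rw [h4] at h1
    simp only [List.getD_cons_zero] at h2
    unfold tupleComplexity at *
    omega

end KTrivial

theorem mainTheorem8
    (U : List Bool →. List Bool) (hU : IsOptimalPrefixFreeMachine U)
    (code : List ℕ → List Bool) (hcode : IsEffectiveEncoding code)
    {M : Type*} [MetricSpace M] (q : ℕ → M) (hq : IsComputableMetricSpace q) :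
    (∃ c : ℕ, ∀ (b : ℕ) (x : M), IsLocallyKTrivialVia U code q x b →
      ∃ h : ℕ → ℕ, IsCauchyName q h x ∧ IsKTrivialVia U code h (b + c)) ∧
    (∃ c : ℕ, ∀ (v : ℕ) (x : M) (f : ℕ → ℕ), IsCauchyName q f x → IsKTrivialVia U code f v →
      IsLocallyKTrivialVia U code q x (v + c)) ∧
    (∀ x : M, IsKTrivialPoint U code q x ↔ ∃ b : ℕ, IsLocallyKTrivialVia U code q x b) := by
  obtain ⟨c₁, h₁⟩ := hU.exists_isKTrivialVia_of_isLocallyKTrivialVia hcode hq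
  obtain ⟨c₂, h₂⟩ := hU.exists_isLocallyKTrivialVia_of_isKTrivialVia (M := M) (q := q) hcode
  refine ⟨⟨c₁, h₁⟩, ⟨c₂, h₂⟩, fun x => ⟨?_, ?_⟩⟩
  · rintro ⟨α, hα, v, hv⟩
    exact ⟨_, h₂ v x α hα hv⟩
  · rintro ⟨b, hb⟩
    obtain ⟨h, hh, hK⟩ := h₁ b x hb
    exact ⟨h, hh, _, hK⟩
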